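/- Work over the max-plus semiring $\mathbb R\cup\{-\infty\}$ (tropical addition $\max$, tropical multiplication $+$), and let $[n]=\{1,\dots,n\}$. A real polyhedral cone $\mathcal C$ is the set of all vectors $\bigl(\max_{r}(\lambda_r+v^r_i)\bigr)_{i\in[n]}$, $\lambda_r\in\mathbb R\cup\{-\infty\}$, for a finite family of vectors $v^r\in\mathbb R^n$; its real vectors are viewed as points of the projective space $\mathbb P^{n-1}=\mathbb R^n/(1,\dots,1)\mathbb R$ (with the quotient topology, which is that of the Hilbert projective metric), and $\partial\mathcal C\subset\mathbb P^{n-1}$ is the boundary of $\mathcal C$ there. For $a\in\mathbb P^{n-1}$ and a non-empty proper subset $I\subset[n]$, the half-space with apex $a$ and set of sectors $I$ is $$\mathcal H(a,I)=\Bigl\{x\in(\mathbb R\cup\{-\infty\})^n : \max_{i\in I}(x_i-a_i)\ge\max_{j\notin I}(x_j-a_j)\Bigr\}.$$ Let $\Sigma$ be the set of half-spaces that contain $\mathcal C$ and have their apex in $\mathcal C$, and let $\Sigma_a$ be the set of half-spaces with apex $a$ that contain $\mathcal C$. For a set $\Gamma$ of half-spaces put $\tau(\Gamma)=\{\mathcal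 H\in\Sigma : \bigcap_{\mathcal H'\in\Gamma}\mathcal H'\subset\mathcal H\}$, and for $X\subset\partial\mathcal C$ put $\tau'(X)=\{a\in\partial\mathcal C : \Sigma_a\subset\tau(\bigcup_{b\in X}\Sigma_b)\}$. A point $a$ is a non-redundant apex of $\mathcal C$ if it belongs to the (unique) minimal finite set $\mathcal A\subset\partial\mathcal C$ such that $\tau'(\mathcal A)=\partial\mathcal C$. Let $a\in\partial\mathcal C$, let $\mathcal H(a,I_1),\dots,\mathcal H(a,I_q)$ be half-spaces in $\Sigma_a$, let $\Lambda\subset\Sigma\setminus\Sigma_a$ be a finite set of half-spaces (so their apices are different from $a$), put $\mathcal D=\bigcap_{\mathcal H\in\Lambda}\mathcal H$, and suppose that $\mathcal C=\mathcal D\cap\bigcap_{l=1}^q\mathcal H(a,I_l)$. The tangent directed hypergraph $\mathcal G(\Lambda,a)$ on the nodes $[n]$ has a hyperarc $(M,N)$ for each $\mathcal H(b,J)\in\Lambda$ with $\max_{i\in J}(a_i-b_i)=\max_{i\notin J}(a_i-b_i)$, where $M\subset J$ and $N\subset[n]\setminus J$ are the sets of indices attaining these two maxima. A node $j$ is reachable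 from $I\subset[n]$ if $j\in I$ or, recursively, there is a hyperarc $(M,N)$ with $j\in N$ all of whose tail nodes $t\in M$ are reachable from $I$. The digraph $\mathcal R(\mathcal D,a)$ has the node set $E_a=\{[n]\}\cup\{I : \mathcal H(a,I)\in\Sigma_a\}$ and an arc from $I$ to $J$ if and only if every element of $J$ is reachable from $I$ in $\mathcal G(\Lambda,a)$. Its strongly connected components are ordered by $K\le K'$ if the nodes of $K'$ can be reached from those of $K$. Then: (i) $a$ is a non-redundant apex of $\mathcal C$ if and only if $\mathcal R(\mathcal D,a)$ is not strongly connected. (ii) If $a$ is a non-redundant apex of $\mathcal C$ then, for every $L\subset[q]$, $L$ is an inclusion-minimal set satisfying $$\tau(\Lambda\cup\{\mathcal H(a,I_l)\}_{l\in L})=\tau(\Lambda\cup\{\mathcal H(a,I_l)\}_{l\in[q]})=\Sigma$$ if and only if the family $(I_l)_{l\in L}$ is composed of precisely one element of each maximal strongly connected component of $\mathcal R(\mathcal D,a)$; that is, each $I_l$ with $l\in L$ lies in a maximal strongly connected component, and each maximal strongly connected component contains $I_l$ for exactly one $l\in L$. -/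

import Mathlib

namespace TropicalCone

/-! ### Max-plus vectors and the real projective space -/

/-- Vectors over the max-plus semiring `ℝ ∪ {-∞}`, modelled by `WithBot ℝ`: tropical addition is
`max`, tropical multiplication is `+`. Tropical cones are sets of such vectors. -/
abbrev TVec (n : ℕ) : Type := Fin n → WithBot ℝ

/-- The inclusion of `ℝⁿ` in the max-plus vectors. -/
def toTVec {n : ℕ} (x : Fin n → ℝ) : TVec n := fun i => ((x i : ℝ) : WithBot ℝ)

/-- Two real vectors are projectively equal if they differ by a tropical scalar, i.e. by a real
multiple of `(1, …, 1)`. -/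
def projSetoid (n : ℕ) : Setoid (Fin n → ℝ) where
  r x y := ∃ c : ℝ, ∀ i, y i = x i + c
  iseqv :=
    { refl := fun _ => ⟨0, fun _ => by ring⟩
      symm := by
        rintro x y ⟨c, h⟩
        exact ⟨-c, fun i => by rw [h i]; ring⟩
      trans := by
        rintro x y z ⟨c, h⟩ ⟨d, h'⟩
        exact ⟨c + d, fun i => by rw [h' i, h i]; ring⟩ }

/-- The real projective space `ℝⁿ / (1, …, 1)ℝ`. -/
def Proj (n : ℕ) : Type := Quotient (projSetoid n)

/-- The class of a real vector in the real projective space. -/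
def Proj.mk {n : ℕ} (x : Fin n → ℝ) : Proj n := Quotient.mk (projSetoid n) x

/-- The quotient topology; it is the topology of the projective Hilbert metric
`max (x i - y i) - min (x i - y i)`. -/
instance (n : ℕ) : TopologicalSpace (Proj n) :=
  inferInstanceAs (TopologicalSpace (Quotient (projSetoid n)))

/-! ### Cones -/

/-- The tropical cone generated by the real vectors `v 0, …, v (p - 1)`: all the tropical linear
combinations, with coefficients in `ℝ ∪ {-∞}`. -/
def coneSpan {n p : ℕ} (v : Fin p → Fin n → ℝ) : Set (TVec n) :=
  {x | ∃ c : Fin p → WithBot ℝ, ∀ i, x i = Finset.univ.sup fun r => c r + toTVec (v r) i}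

/-- Real polyhedral cones: tropical cones generated by finitely many real vectors. -/
def IsRealPolyhedralCone {n : ℕ} (C : Set (TVec n)) : Prop :=
  ∃ (p : ℕ) (v : Fin p → Fin n → ℝ), C = coneSpan v

/-- The image in the real projective space of the real vectors of `C`. -/
def projImage {n : ℕ} (C : Set (TVec n)) : Set (Proj n) :=
  {a | ∃ x : Fin n → ℝ, Proj.mk x = a ∧ toTVec x ∈ C}

/-- The boundary of `C` in the real projective space. -/
def bdry {n : ℕ} (C : Set (TVec n)) : Set (Proj n) := frontier (projImage C)

/-! ### Half-spaces -/

/-- A (non-degenerate) tropical half-space, given by its apex and its set of sectors, which is a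
nonempty proper subset of the set of coordinates. Both are determined by the half-space. -/
@[ext]
structure HalfSpace (n : ℕ) where
  apex : Proj n
  sect : Finset (Fin n)
  sect_nonempty : sect.Nonempty
  sect_ne_univ : sect ≠ Finset.univ

/-- `max_{i ∈ S} (x i - b i)`, which is `-∞` if `S` is empty. -/
def maxDiff {n : ℕ} (S : Finset (Fin n)) (b : Fin n → ℝ) (x : TVec n) : WithBot ℝ :=
  S.sup fun i => x i + ((-(b i) : ℝ) : WithBot ℝ)

/-- The set of max-plus vectors with `max_{i ∈ I} (x i - b i) ≥ max_{j ∉ I} (x j - b j)`, where `b`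
is a representative of the apex and `I` is the set of sectors (the inequality does not depend on
the representative, see `HalfSpace.mem_toSet_iff`). -/
def HalfSpace.toSet {n : ℕ} (H : HalfSpace n) : Set (TVec n) :=
  {x | ∃ b : Fin n → ℝ, Proj.mk b = H.apex ∧ maxDiff H.sectᶜ b x ≤ maxDiff H.sect b x}

theorem maxDiff_add_const {n : ℕ} (S : Finset (Fin n)) (b b' : Fin n → ℝ) (c : ℝ)
    (h : ∀ i, b' i = b i + c) (x : TVec n) :
    maxDiff S b' x = maxDiff S b x + ((-c : ℝ) : WithBot ℝ) := by
  unfold maxDiff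
  rw [Finset.apply_sup_eq_sup_comp_of_linearOrder (fun y : WithBot ℝ => y + ((-c : ℝ) : WithBot ℝ))
    (fun _ _ hxy => add_le_add_left hxy _) (by simp)]
  refine Finset.sup_congr rfl fun i _ => ?_
  simp only [Function.comp]
  rw [add_assoc, ← WithBot.coe_add, h i, neg_add]

theorem HalfSpace.mem_toSet_iff {n : ℕ} (H : HalfSpace n) (b : Fin n → ℝ)
    (hb : Proj.mk b = H.apex) (x : TVec n) :
    x ∈ H.toSet ↔ maxDiff H.sectᶜ b x ≤ maxDiff H.sect b x := by
  refine ⟨?_, fun h => ⟨b, hb, h⟩⟩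
  rintro ⟨b', hb', h⟩
  obtain ⟨c, hc⟩ : ∃ c : ℝ, ∀ i, b i = b' i + c := Quotient.exact (hb'.trans hb.symm)
  rw [maxDiff_add_const _ b' b c hc, maxDiff_add_const _ b' b c hc]
  gcongr

/-- The intersection of a set of half-spaces (everything if the set is empty). -/
def inter {n : ℕ} (Γ : Set (HalfSpace n)) : Set (TVec n) := ⋂ H ∈ Γ, H.toSet

/-- `Σ`: the half-spaces that contain `C` and have their apex in `C`. -/
def sigma {n : ℕ} (C : Set (TVec n)) : Set (HalfSpace n) :=
  {H | C ⊆ H.toSet ∧ H.apex ∈ projImage C}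

/-- `Σ_a`: the half-spaces with apex `a` that contain `C`. -/
def sigmaAt {n : ℕ} (C : Set (TVec n)) (a : Proj n) : Set (HalfSpace n) :=
  {H | H.apex = a ∧ C ⊆ H.toSet}

/-- `τ(Γ)`: the half-spaces of `Σ` that are implied by those of `Γ`. -/
def tau {n : ℕ} (C : Set (TVec n)) (Γ : Set (HalfSpace n)) : Set (HalfSpace n) :=
  {H | H ∈ sigma C ∧ inter Γ ⊆ H.toSet}

/-- `τ'(X)`: the boundary points `a` such that the half-spaces of `Σ_a` are all implied by the
half-spaces of the sets `Σ_b`, `b ∈ X`. -/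
def tau' {n : ℕ} (C : Set (TVec n)) (X : Set (Proj n)) : Set (Proj n) :=
  {a | a ∈ bdry C ∧ sigmaAt C a ⊆ tau C (⋃ b ∈ X, sigmaAt C b)}

/-- `X` is a minimal finite subset of the boundary of `C` with `τ'(X)` the whole boundary. -/
def IsMinimalSpanning {n : ℕ} (C : Set (TVec n)) (X : Set (Proj n)) : Prop :=
  Minimal (fun Y : Set (Proj n) => Y ⊆ bdry C ∧ Y.Finite ∧ tau' C Y = bdry C) X

/-- `a` is a non-redundant apex of `C`: it belongs to the minimal finite spanning set of the
boundary of `C`. -/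
def IsNonredundantApex {n : ℕ} (C : Set (TVec n)) (a : Proj n) : Prop :=
  ∃ X, IsMinimalSpanning C X ∧ a ∈ X

/-! ### The tangent directed hypergraph -/

/-- A directed hypergraph on the nodes `Fin n`: a set of hyperarcs (tail, head). -/
abbrev Hypergraph (n : ℕ) : Type := Set (Finset (Fin n) × Finset (Fin n))

/-- The node `j` is reachable from the set of nodes `I` in the directed hypergraph `G`. -/
inductive Hypergraph.Reach {n : ℕ} (G : Hypergraph n) (I : Finset (Fin n)) : Fin n → Prop
  | base {j : Fin n} (hj : j ∈ I) : Hypergraph.Reach G I j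
  | arc {T N : Finset (Fin n)} {j : Fin n} (hG : (T, N) ∈ G)
      (hT : ∀ t ∈ T, Hypergraph.Reach G I t) (hj : j ∈ N) : Hypergraph.Reach G I j

/-- The indices attaining `max_{i ∈ S} (z i - b i)`. -/
noncomputable def argmaxDiff {n : ℕ} (S : Finset (Fin n)) (b z : Fin n → ℝ) : Finset (Fin n) :=
  S.filter fun i => ∀ k ∈ S, z k - b k ≤ z i - b i

/-- The tangent directed hypergraph at `a` induced by `Γ`: each half-space of `Γ` with apex `b` and
sectors `J` that is active at `a`, i.e. `max_{i ∈ J} (a i - b i) = max_{i ∉ J} (a i - b i)`, gives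
the hyperarc formed by the two sets of maximizers. The representatives of the apices are
irrelevant. -/
def tangentHypergraph {n : ℕ} (Γ : Set (HalfSpace n)) (a : Proj n) : Hypergraph n :=
  {e | ∃ H ∈ Γ, ∃ b z : Fin n → ℝ, Proj.mk b = H.apex ∧ Proj.mk z = a ∧
    maxDiff H.sect b (toTVec z) = maxDiff H.sectᶜ b (toTVec z) ∧
    e = (argmaxDiff H.sect b z, argmaxDiff H.sectᶜ b z)}

/-! ### Strong connectivity in directed graphs -/

/-- There is a directed path (possibly of length `0`) from `u` to `v`. -/
def DiPath {V : Type*} (G : Digraph V) (u v : V) : Prop := Relation.ReflTransGen G.Adj u v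

/-- Every node can be reached from every node. -/
def StronglyConnected {V : Type*} (G : Digraph V) : Prop := ∀ u v : V, DiPath G u v

/-- Strongly connected components: the classes of mutually reachable nodes. -/
def IsSCC {V : Type*} (G : Digraph V) (K : Set V) : Prop :=
  ∃ u : V, K = {v | DiPath G u v ∧ DiPath G v u}

/-- A strongly connected component is maximal if it is maximal in the order on components for which
`K ≤ K'` when the nodes of `K'` are reachable from those of `K`. -/
def IsMaximalSCC {V : Type*} (G : Digraph V) (K : Set V) : Prop :=
  IsSCC G K ∧ ∀ K', IsSCC G K' → (∀ u ∈ K, ∀ v ∈ K', DiPath G u v) → K' = K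

/-! ### The reachability digraph -/

/-- `E_a`: the whole set of coordinates, and the sets of sectors of the half-spaces with apex `a`
that contain `C`. -/
def sectorSets {n : ℕ} (C : Set (TVec n)) (a : Proj n) : Set (Finset (Fin n)) :=
  {Finset.univ} ∪ HalfSpace.sect '' sigmaAt C a

/-- The reachability digraph `R(D, a)` on `E_a`, with `D` the intersection of the half-spaces of
`Γ`: there is an arc from `I` to `J` when each node of `J` is reachable from `I` in the tangent
directed hypergraph at `a` induced by `Γ`. -/
def reachDigraph {n : ℕ} (C : Set (TVec n)) (Γ : Set (HalfSpace n)) (a : Proj n) :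
    Digraph (sectorSets C a) where
  Adj I J := ∀ j ∈ J.1, (tangentHypergraph Γ a).Reach I.1 j

/-- The node of the reachability digraph given by a half-space of `Σ_a`. -/
def sectorNode {n : ℕ} {C : Set (TVec n)} {a : Proj n} (H : HalfSpace n) (hH : H ∈ sigmaAt C a) :
    sectorSets C a :=
  ⟨H.sect, Or.inr ⟨H, hH, rfl⟩⟩

/-- Together with `Γ`, the half-spaces `H l`, `l ∈ L`, imply the same half-spaces of `Σ` as all the
half-spaces `H l` do, namely the whole of `Σ`. -/
def IsCompletion {n q : ℕ} (C : Set (TVec n)) (Γ : Set (HalfSpace n)) (H : Fin q → HalfSpace n)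
    (L : Set (Fin q)) : Prop :=
  tau C (Γ ∪ H '' L) = tau C (Γ ∪ Set.range H) ∧ tau C (Γ ∪ Set.range H) = sigma C

/-- The family `N l`, `l ∈ L`, of nodes of `G` is composed of precisely one element of each maximal
strongly connected component of `G`. -/
def IsTransversalOfMaximalSCCs {V ι : Type*} (G : Digraph V) (N : ι → V) (L : Set ι) : Prop :=
  (∀ l ∈ L, ∃ K, IsMaximalSCC G K ∧ N l ∈ K) ∧
    ∀ K, IsMaximalSCC G K → ∃! l, l ∈ L ∧ N l ∈ K

end TropicalCone

namespace TropicalCone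

open Filter Topology

variable {n : ℕ}

/-! ### Membership in half-spaces -/

/-! A point `y` lies in `H(a, I)` exactly when the maximum of `y - a` is attained in `I`. Two facts
turn inclusions into reachability. Maxima propagate backwards: if `J` is reachable from `I`, then
for `y` in `D` a maximum attained in `J` is also attained in `I` (`exists_max_of_reach`), so `D ∩
H(a, J) ⊆ H(a, I)`. Conversely, let `R` be the set of nodes reachable from `I`. Raising the
coordinates of `a` outside `R` by a small `ε` stays in `D`, and in `H(a, J)` unless `J ⊆ R`
(`eventually_raise_mem`), but leaves `H(a, I)` unless `R = [n]` (`raise_notMem`). So `D` and the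
`H(a, I_l)`, `l ∈ L`, imply `H(a, I)` iff `I` leads to `[n]` or to some `I_l`
(`inter_union_image_subset_iff`).

As `[n]` leads to every node, strong connectivity means `D ⊆ C`. Part (i) is thus that `a` is
redundant iff `D ⊆ C`; this rests on an anti-exchange property (`inter_subset_of_inter_subset`): if
some finite representation by half-spaces of `Σ` avoids the apex `a`, then `a` can be dropped from
all of them. For (ii), `L` is a completion iff every node leads to `[n]` or to some `I_l`, that is,
iff the `I_l` meet every maximal component; minimal such sets are transversals. -/

theorem HalfSpace.mem_iff_exists (H : HalfSpace n) {b : Fin n → ℝ} (hb : Proj.mk b = H.apex)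
    (x : TVec n) :
    x ∈ H.toSet ↔ ∃ i ∈ H.sect, ∀ k,
      x k + ((-(b k) : ℝ) : WithBot ℝ) ≤ x i + ((-(b i) : ℝ) : WithBot ℝ) := by
  rw [H.mem_toSet_iff b hb]
  constructor
  · intro h
    obtain ⟨i, hi, he⟩ := Finset.exists_mem_eq_sup H.sect H.sect_nonempty
      fun i => x i + ((-(b i) : ℝ) : WithBot ℝ)
    refine ⟨i, hi, fun k => ?_⟩
    rw [← he]
    by_cases hk : k ∈ H.sect
    · exact Finset.le_sup (f := fun i => x i + ((-(b i) : ℝ) : WithBot ℝ)) hk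
    · exact (Finset.le_sup (f := fun i => x i + ((-(b i) : ℝ) : WithBot ℝ))
        (Finset.mem_compl.2 hk)).trans h
  · rintro ⟨i, hi, h⟩
    exact (Finset.sup_le fun k _ => h k).trans
      (Finset.le_sup (f := fun i => x i + ((-(b i) : ℝ) : WithBot ℝ)) hi)

theorem HalfSpace.toTVec_mem_iff (H : HalfSpace n) {b : Fin n → ℝ} (hb : Proj.mk b = H.apex)
    (x : Fin n → ℝ) :
    toTVec x ∈ H.toSet ↔ ∃ i ∈ H.sect, ∀ k, x k - b k ≤ x i - b i := by
  rw [H.mem_iff_exists hb]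
  simp only [toTVec, ← WithBot.coe_add, WithBot.coe_le_coe, sub_eq_add_neg]

theorem Proj.mk_eq_iff {x y : Fin n → ℝ} : Proj.mk x = Proj.mk y ↔ ∃ c : ℝ, ∀ i, y i = x i + c :=
  ⟨fun h => Quotient.exact h, fun h => Quotient.sound h⟩

theorem Proj.exists_rep (a : Proj n) : ∃ z : Fin n → ℝ, Proj.mk z = a := Quotient.exists_rep a

theorem HalfSpace.toTVec_mem_congr (H : HalfSpace n) {x y : Fin n → ℝ}
    (h : Proj.mk x = Proj.mk y) : toTVec x ∈ H.toSet ↔ toTVec y ∈ H.toSet := by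
  obtain ⟨b, hb⟩ := Proj.exists_rep H.apex
  obtain ⟨c, hc⟩ := Proj.mk_eq_iff.1 h
  rw [H.toTVec_mem_iff hb, H.toTVec_mem_iff hb]
  refine exists_congr fun i => and_congr_right fun _ => forall_congr' fun k => ?_
  rw [hc, hc]
  constructor <;> intro h <;> linarith

theorem HalfSpace.toTVec_mem_of_mem_projImage {C : Set (TVec n)} {H : HalfSpace n}
    (hH : C ⊆ H.toSet) {z : Fin n → ℝ} (hz : Proj.mk z ∈ projImage C) : toTVec z ∈ H.toSet := by
  obtain ⟨x, hx, hxC⟩ := hz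
  exact (H.toTVec_mem_congr hx).1 (hH hxC)

theorem HalfSpace.toTVec_sup_mem (H : HalfSpace n) {x y : Fin n → ℝ} (hx : toTVec x ∈ H.toSet)
    (hy : toTVec y ∈ H.toSet) : toTVec (x ⊔ y) ∈ H.toSet := by
  obtain ⟨b, hb⟩ := Proj.exists_rep H.apex
  rw [H.toTVec_mem_iff hb] at *
  obtain ⟨i, hi, h⟩ := hx
  obtain ⟨j, hj, h'⟩ := hy
  rcases le_total (x i - b i) (y j - b j) with hle | hle
  · refine ⟨j, hj, fun k => ?_⟩
    have h1 := le_sup_right (a := x j) (b := y j)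
    have : x k ⊔ y k ≤ y j - b j + b k := sup_le (by linarith [h k]) (by linarith [h' k])
    simp only [Pi.sup_apply]
    linarith
  · refine ⟨i, hi, fun k => ?_⟩
    have h1 := le_sup_left (a := x i) (b := y i)
    have : x k ⊔ y k ≤ x i - b i + b k := sup_le (by linarith [h k]) (by linarith [h' k])
    simp only [Pi.sup_apply]
    linarith

theorem mem_inter {Γ : Set (HalfSpace n)} {x : TVec n} :
    x ∈ inter Γ ↔ ∀ H ∈ Γ, x ∈ H.toSet := by
  simp [inter]

/-! ### The tangent hypergraph -/

/-- Normalized form of an active apex: `b` touches `z` from above both inside and outside `J`. -/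
def Touches (J : Finset (Fin n)) (b z : Fin n → ℝ) : Prop :=
  (∀ i, z i ≤ b i) ∧ (∃ i ∈ J, z i = b i) ∧ ∃ i ∉ J, z i = b i

theorem maxDiff_toTVec {S : Finset (Fin n)} {b z : Fin n → ℝ} {i : Fin n} (hi : i ∈ S)
    (h : ∀ k ∈ S, z k - b k ≤ z i - b i) :
    maxDiff S b (toTVec z) = ((z i - b i : ℝ) : WithBot ℝ) := by
  have hc : ∀ k, toTVec z k + ((-(b k) : ℝ) : WithBot ℝ) = ((z k - b k : ℝ) : WithBot ℝ) := by
    intro k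
    rw [sub_eq_add_neg, WithBot.coe_add]
    rfl
  unfold maxDiff
  simp only [hc]
  exact le_antisymm (Finset.sup_le fun k hk => WithBot.coe_le_coe.2 (h k hk))
    (Finset.le_sup (f := fun k => ((z k - b k : ℝ) : WithBot ℝ)) hi)

theorem argmaxDiff_eq_filter {S : Finset (Fin n)} {b z : Fin n → ℝ} (h : ∀ i, z i ≤ b i)
    (hS : ∃ i ∈ S, z i = b i) : argmaxDiff S b z = S.filter fun i => z i = b i := by
  obtain ⟨i, hi, he⟩ := hS
  refine Finset.filter_congr fun k _ => ⟨fun hk => ?_, fun hk l _ => ?_⟩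
  · linarith [hk i hi, h k]
  · linarith [h l]

theorem HalfSpace.compl_sect_nonempty (H : HalfSpace n) : H.sectᶜ.Nonempty := by
  rw [Finset.nonempty_iff_ne_empty, Ne, Finset.compl_eq_empty_iff]
  exact H.sect_ne_univ

/-- Translating the representative of an active apex makes both maxima `0`; the hyperarc is then the
contact set `z i = b i`, split by the sectors. -/
theorem mem_tangentHypergraph_iff {Γ : Set (HalfSpace n)} {z : Fin n → ℝ}
    {e : Finset (Fin n) × Finset (Fin n)} :
    e ∈ tangentHypergraph Γ (Proj.mk z) ↔ ∃ H ∈ Γ, ∃ b : Fin n → ℝ, Proj.mk b = H.apex ∧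
      Touches H.sect b z ∧
      e = (H.sect.filter fun i => z i = b i, H.sectᶜ.filter fun i => z i = b i) := by
  constructor
  · rintro ⟨H, hH, b, y, hb, hy, hmax, rfl⟩
    obtain ⟨c, hc⟩ := Proj.mk_eq_iff.1 hy
    obtain ⟨i, hi, hi'⟩ := Finset.exists_max_image H.sect (fun k => y k - b k) H.sect_nonempty
    obtain ⟨j, hj, hj'⟩ :=
      Finset.exists_max_image H.sectᶜ (fun k => y k - b k) H.compl_sect_nonempty
    rw [maxDiff_toTVec hi hi', maxDiff_toTVec hj hj', WithBot.coe_inj] at hmax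
    have hle : ∀ k, y k - b k ≤ y i - b i := fun k => by
      by_cases hk : k ∈ H.sect
      · exact hi' k hk
      · exact (hj' k (Finset.mem_compl.2 hk)).trans hmax.ge
    set d := c + (y i - b i) with hd
    have hdiff : ∀ k, z k - (b k + d) = y k - b k - (y i - b i) := fun k => by
      rw [hc, hd]; ring
    have ht : Touches H.sect (fun k => b k + d) z := by
      refine ⟨fun k => ?_, ⟨i, hi, ?_⟩, j, Finset.mem_compl.1 hj, ?_⟩
      · linarith [hle k, hdiff k]
      · linarith [hdiff i]
      · linarith [hdiff j]
    refine ⟨H, hH, fun k => b k + d, ?_, ht, ?_⟩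
    · rw [← hb]
      exact (Proj.mk_eq_iff.2 ⟨d, fun _ => rfl⟩).symm
    · have harg : ∀ S : Finset (Fin n), argmaxDiff S b y = argmaxDiff S (fun k => b k + d) z := by
        intro S
        refine Finset.filter_congr fun k _ => forall₂_congr fun l _ => ?_
        rw [hdiff, hdiff]
        exact (sub_le_sub_iff_right _).symm
      rw [harg, harg, argmaxDiff_eq_filter ht.1 ht.2.1,
        argmaxDiff_eq_filter ht.1]
      obtain ⟨k, hk, hk'⟩ := ht.2.2
      exact ⟨k, Finset.mem_compl.2 hk, hk'⟩
  · rintro ⟨H, hH, b, hb, ht, rfl⟩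
    obtain ⟨hle, ⟨i, hi, hie⟩, j, hj, hje⟩ := ht
    have hj := Finset.mem_compl.2 hj
    refine ⟨H, hH, b, z, hb, rfl, ?_, ?_⟩
    · rw [maxDiff_toTVec hi fun k _ => by linarith [hle k],
        maxDiff_toTVec hj fun k _ => by linarith [hle k], WithBot.coe_inj]
      linarith
    · rw [argmaxDiff_eq_filter hle ⟨i, hi, hie⟩,
        argmaxDiff_eq_filter hle ⟨j, hj, hje⟩]

theorem Hypergraph.Reach.trans {G : Hypergraph n} {I J : Finset (Fin n)}
    (hIJ : ∀ j ∈ J, G.Reach I j) {k : Fin n} (h : G.Reach J k) : G.Reach I k := by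
  induction h with
  | base hj => exact hIJ _ hj
  | arc hG _ hj ih => exact .arc hG ih hj

/-- `R` is closed under the hyperarc which `H` induces at `z`. -/
def ClosedUnder (H : HalfSpace n) (z : Fin n → ℝ) (R : Set (Fin n)) : Prop :=
  ∀ b : Fin n → ℝ, Proj.mk b = H.apex → Touches H.sect b z →
    (∀ i ∈ H.sect, z i = b i → i ∈ R) → ∀ j ∉ H.sect, z j = b j → j ∈ R

theorem closedUnder_reach {Γ : Set (HalfSpace n)} {H : HalfSpace n} (hH : H ∈ Γ)
    (z : Fin n → ℝ) (I : Finset (Fin n)) :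
    ClosedUnder H z {j | (tangentHypergraph Γ (Proj.mk z)).Reach I j} := by
  intro b hb ht hM j hj hje
  refine .arc (mem_tangentHypergraph_iff.2 ⟨H, hH, b, hb, ht, rfl⟩) (fun t ht' => ?_)
    (Finset.mem_filter.2 ⟨Finset.mem_compl.2 hj, hje⟩)
  obtain ⟨h1, h2⟩ := Finset.mem_filter.1 ht'
  exact hM t h1 h2

/-- A representative of the apex that touches `z` equals `z`, so the tail of the hyperarc is all of
`H.sect` and the condition is vacuous. -/
theorem closedUnder_of_apex_eq {H : HalfSpace n} {z : Fin n → ℝ} (hz : H.apex = Proj.mk z)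
    {R : Set (Fin n)} (hR : ¬ (H.sect : Set (Fin n)) ⊆ R) : ClosedUnder H z R := by
  intro b hb ht hM
  refine absurd (fun i hi => hM i hi ?_) hR
  obtain ⟨c, hc⟩ := Proj.mk_eq_iff.1 (hb.trans hz)
  obtain ⟨-, ⟨k, -, hk⟩, -⟩ := ht
  linarith [hc k, hc i]

/-- If the coordinates of `J` are reachable from `I` and the differences `y k - z k` have their
maximum in `J`, then they have it in `I`. -/
theorem exists_max_of_reach {Γ : Set (HalfSpace n)} {z : Fin n → ℝ} {I J : Finset (Fin n)}
    (hI : I.Nonempty) (hIJ : ∀ j ∈ J, (tangentHypergraph Γ (Proj.mk z)).Reach I j)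
    {y : TVec n} (hy : y ∈ inter Γ)
    (hJ : ∃ j ∈ J, ∀ k, y k + ((-(z k) : ℝ) : WithBot ℝ) ≤ y j + ((-(z j) : ℝ) : WithBot ℝ)) :
    ∃ i ∈ I, ∀ k, y k + ((-(z k) : ℝ) : WithBot ℝ) ≤ y i + ((-(z i) : ℝ) : WithBot ℝ) := by
  obtain ⟨j, hj, hmax⟩ := hJ
  by_contra hcon
  -- If the maximum is `-∞`, every element of `I` attains it.
  have hbot : y j ≠ ⊥ := by
    intro h
    obtain ⟨i, hi⟩ := hI
    refine hcon ⟨i, hi, fun k => (hmax k).trans ?_⟩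
    simp [h]
  -- No node reachable from `I` attains the maximum. If a head node `k` did, the coordinate `i`
  -- witnessing `y ∈ H` would be squeezed: `z i = b i` and `i` also attains the maximum, so `i` is a
  -- tail node, against the induction hypothesis.
  have key : ∀ k, (tangentHypergraph Γ (Proj.mk z)).Reach I k →
      ¬ y j + ((-(z j) : ℝ) : WithBot ℝ) ≤ y k + ((-(z k) : ℝ) : WithBot ℝ) := by
    intro k hk
    induction hk with
    | base hk => exact fun h => hcon ⟨_, hk, fun l => (hmax l).trans h⟩
    | @arc T N k hG _ hkN ih =>
      intro hle
      obtain ⟨H, hH, b, hb, ht, he⟩ := mem_tangentHypergraph_iff.1 hG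
      obtain ⟨rfl, rfl⟩ := Prod.mk.inj he
      obtain ⟨-, hkb⟩ := Finset.mem_filter.1 hkN
      obtain ⟨i, hi, hiy⟩ := (H.mem_iff_exists hb y).1 (mem_inter.1 hy H hH)
      have h1 := hle.trans (hkb ▸ hiy k)
      have h2 := hmax i
      obtain ⟨r, hr⟩ := WithBot.ne_bot_iff_exists.1 hbot
      have hib : y i ≠ ⊥ := by
        intro h
        rw [h, ← hr, ← WithBot.coe_add] at h1
        simp at h1
      obtain ⟨s, hs⟩ := WithBot.ne_bot_iff_exists.1 hib
      rw [← hr, ← hs, ← WithBot.coe_add, ← WithBot.coe_add, WithBot.coe_le_coe] at h1 h2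
      have hzb : z i = b i := by linarith [ht.1 i]
      refine ih i (Finset.mem_filter.2 ⟨hi, hzb⟩) ?_
      rw [← hr, ← hs, ← WithBot.coe_add, ← WithBot.coe_add, WithBot.coe_le_coe]
      linarith
  exact key j (hIJ j hj) le_rfl

open Classical in
/-- The point obtained from `z` by raising the coordinates outside `R` by `ε`. -/
noncomputable def raise (z : Fin n → ℝ) (R : Set (Fin n)) (ε : ℝ) : Fin n → ℝ :=
  fun i => if i ∈ R then z i else z i + ε

theorem raise_of_mem {z : Fin n → ℝ} {R : Set (Fin n)} {i : Fin n} (hi : i ∈ R) (ε : ℝ) :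
    raise z R ε i = z i := if_pos hi

theorem raise_of_notMem {z : Fin n → ℝ} {R : Set (Fin n)} {i : Fin n} (hi : i ∉ R) (ε : ℝ) :
    raise z R ε i = z i + ε := if_neg hi

theorem le_raise {z : Fin n → ℝ} {R : Set (Fin n)} {ε : ℝ} (hε : 0 ≤ ε) (i : Fin n) :
    z i ≤ raise z R ε i := by
  by_cases hi : i ∈ R
  · rw [raise_of_mem hi]
  · rw [raise_of_notMem hi]; linarith

theorem raise_le {z : Fin n → ℝ} {R : Set (Fin n)} {ε : ℝ} (hε : 0 ≤ ε) (i : Fin n) :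
    raise z R ε i ≤ z i + ε := by
  by_cases hi : i ∈ R
  · rw [raise_of_mem hi]; linarith
  · rw [raise_of_notMem hi]

/-- Take a representative `b ≥ z` in contact with `z` inside the sectors. If the tail lies in `R`,
closedness puts every contact coordinate in `R`; these do not move and the others have slack.
Otherwise a raised tail coordinate reaches `b + ε`, which bounds everything. -/
theorem eventually_raise_mem {H : HalfSpace n} {z : Fin n → ℝ} (hz : toTVec z ∈ H.toSet)
    {R : Set (Fin n)} (hR : ClosedUnder H z R) :
    ∀ᶠ ε : ℝ in 𝓝[>] 0, toTVec (raise z R ε) ∈ H.toSet := by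
  obtain ⟨b', hb'⟩ := Proj.exists_rep H.apex
  obtain ⟨i, hi, hmax⟩ := (H.toTVec_mem_iff hb' z).1 hz
  obtain ⟨b, hbdef⟩ : ∃ b : Fin n → ℝ, b = fun k => b' k + (z i - b' i) := ⟨_, rfl⟩
  have hb : Proj.mk b = H.apex :=
    hb' ▸ (Proj.mk_eq_iff.2 ⟨z i - b' i, fun k => by rw [hbdef]⟩).symm
  have hle : ∀ k, z k ≤ b k := fun k => by rw [hbdef]; linarith [hmax k]
  have hie : z i = b i := by rw [hbdef]; ring
  have hsmall : ∀ᶠ ε : ℝ in 𝓝[>] 0, ∀ k, z k < b k → z k + ε ≤ b k := by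
    refine eventually_all.2 fun k => ?_
    by_cases hk : z k < b k
    · filter_upwards [Ioo_mem_nhdsGT (sub_pos.2 hk)] with ε hε _
      linarith [hε.2]
    · exact Eventually.of_forall fun _ h => absurd h hk
  filter_upwards [hsmall, self_mem_nhdsWithin] with ε hε hpos
  have hpos : (0 : ℝ) < ε := hpos
  rw [H.toTVec_mem_iff hb]
  by_cases hM : ∀ k ∈ H.sect, z k = b k → k ∈ R
  · have hR' : ∀ k, z k = b k → k ∈ R := by
      intro k hk
      by_cases hkJ : k ∈ H.sect
      · exact hM k hkJ hk
      · exact hR b hb ⟨hle, ⟨i, hi, hie⟩, k, hkJ, hk⟩ hM k hkJ hk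
    refine ⟨i, hi, fun k => ?_⟩
    have h1 := le_raise (z := z) (R := R) hpos.le i
    rcases (hle k).lt_or_eq with hk | hk
    · linarith [hε k hk, raise_le (z := z) (R := R) hpos.le k]
    · linarith [raise_of_mem (z := z) (hR' k hk) ε]
  · push Not at hM
    obtain ⟨k, hkJ, hk, hkR⟩ := hM
    refine ⟨k, hkJ, fun l => ?_⟩
    linarith [raise_of_notMem (z := z) hkR ε, raise_le (z := z) (R := R) hpos.le l, hle l]

theorem exists_raise_mem_inter {Γ : Set (HalfSpace n)} (hfin : Γ.Finite) {z : Fin n → ℝ}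
    (hz : toTVec z ∈ inter Γ) {R : Set (Fin n)} (hR : ∀ H ∈ Γ, ClosedUnder H z R) :
    ∃ ε : ℝ, 0 < ε ∧ toTVec (raise z R ε) ∈ inter Γ := by
  have h : ∀ᶠ ε : ℝ in 𝓝[>] 0, ∀ H ∈ Γ, toTVec (raise z R ε) ∈ H.toSet :=
    (eventually_all_finite hfin).2 fun H hH => eventually_raise_mem (mem_inter.1 hz H hH) (hR H hH)
  obtain ⟨ε, hε, hpos⟩ := (h.and self_mem_nhdsWithin).exists
  exact ⟨ε, hpos, mem_inter.2 hε⟩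

theorem raise_notMem {H : HalfSpace n} {z : Fin n → ℝ} (hz : Proj.mk z = H.apex)
    {R : Set (Fin n)} (hHR : (H.sect : Set (Fin n)) ⊆ R) (hR : R ≠ Set.univ) {ε : ℝ}
    (hε : 0 < ε) : toTVec (raise z R ε) ∉ H.toSet := by
  rw [H.toTVec_mem_iff hz]
  rintro ⟨i, hi, h⟩
  obtain ⟨k, hk⟩ := (Set.ne_univ_iff_exists_notMem R).1 hR
  have := h k
  rw [raise_of_mem (hHR hi), raise_of_notMem hk] at this
  linarith

theorem inter_subset_of_reach {Γ : Set (HalfSpace n)} {H : HalfSpace n}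
    {J : Finset (Fin n)} (hreach : ∀ j ∈ J, (tangentHypergraph Γ H.apex).Reach H.sect j)
    {y : TVec n} (hy : y ∈ inter Γ) (hJ : J = Finset.univ ∨
      ∃ H' : HalfSpace n, H'.apex = H.apex ∧ H'.sect = J ∧ y ∈ H'.toSet) : y ∈ H.toSet := by
  obtain ⟨z, hz⟩ := Proj.exists_rep H.apex
  rw [← hz] at hreach
  rw [H.mem_iff_exists hz]
  refine exists_max_of_reach H.sect_nonempty hreach hy ?_
  rcases hJ with rfl | ⟨H', ha, rfl, hy'⟩
  · have : Nonempty (Fin n) := ⟨H.sect_nonempty.choose⟩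
    obtain ⟨j, -, hj⟩ := Finset.exists_max_image Finset.univ
      (fun k => y k + ((-(z k) : ℝ) : WithBot ℝ)) Finset.univ_nonempty
    exact ⟨j, Finset.mem_univ j, fun k => hj k (Finset.mem_univ k)⟩
  · exact (H'.mem_iff_exists (hz.trans ha.symm) y).1 hy'

/-- A half-space whose apex lies in all the half-spaces of the finite set `Γ` contains their
intersection if and only if all coordinates are reachable from its sectors. -/
theorem inter_subset_iff_reach {Γ : Set (HalfSpace n)} (hfin : Γ.Finite) {H : HalfSpace n}
    (hΓ : ∀ z, Proj.mk z = H.apex → toTVec z ∈ inter Γ) :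
    inter Γ ⊆ H.toSet ↔ ∀ j, (tangentHypergraph Γ H.apex).Reach H.sect j := by
  refine ⟨fun h => ?_, fun h y hy => inter_subset_of_reach (J := Finset.univ)
    (fun j _ => h j) hy (Or.inl rfl)⟩
  obtain ⟨z, hz⟩ := Proj.exists_rep H.apex
  by_contra hcon
  obtain ⟨ε, hε, hmem⟩ := exists_raise_mem_inter hfin (hΓ z hz)
    (R := {j | (tangentHypergraph Γ (Proj.mk z)).Reach H.sect j})
    fun H' hH' => closedUnder_reach hH' z _
  refine raise_notMem hz (fun i hi => .base hi) ?_ hε (h hmem)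
  rw [hz]
  exact fun h' => hcon fun j => (Set.eq_univ_iff_forall.1 h') j

/-! ### The anti-exchange property -/

theorem toTVec_mem_inter {C : Set (TVec n)} {Γ : Set (HalfSpace n)} (hΓ : Γ ⊆ sigma C)
    {z : Fin n → ℝ} (hz : Proj.mk z ∈ projImage C) : toTVec z ∈ inter Γ :=
  mem_inter.2 fun _ hH => HalfSpace.toTVec_mem_of_mem_projImage (hΓ hH).1 hz

/-- If a head node `j` of `H` were outside `R`, the supremum of the raised point and a translate of
the apex `b` of `H` would lie in `C` but violate `H`. -/
theorem closedUnder_of_closedUnder {C : Set (TVec n)} {Γ : Set (HalfSpace n)} (hfin : Γ.Finite)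
    (hΓ : Γ ⊆ sigma C) {z : Fin n → ℝ} (hz : Proj.mk z ∈ projImage C)
    (hC : inter Γ ∩ inter (sigmaAt C (Proj.mk z)) ⊆ C) {R : Set (Fin n)}
    (hR : ∀ H ∈ Γ, ClosedUnder H z R) {H : HalfSpace n} (hH : H ∈ sigma C)
    (hne : H.apex ≠ Proj.mk z) : ClosedUnder H z R := by
  intro b hb ht hM j hj hje
  by_contra hjR
  have hbC : Proj.mk b ∈ projImage C := hb ▸ hH.2
  obtain ⟨ε, hε, hx⟩ := exists_raise_mem_inter hfin (toTVec_mem_inter hΓ hz) hR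
  obtain ⟨t, -, htmax⟩ :=
    Finset.exists_max_image Finset.univ (fun k => b k - z k) ⟨j, Finset.mem_univ j⟩
  replace htmax : ∀ k, b k - z k ≤ b t - z t := fun k => htmax k (Finset.mem_univ k)
  have hm : 0 < b t - z t := by
    by_contra hm
    refine hne (hb ▸ Proj.mk_eq_iff.2 ⟨0, fun i => ?_⟩)
    linarith [ht.1 i, htmax i]
  -- The translation is chosen so that `y ≤ z + ε`, with equality at `t`.
  obtain ⟨y, hy⟩ : ∃ y : Fin n → ℝ, ∀ k, y k = b k + (ε - (b t - z t)) := ⟨_, fun _ => rfl⟩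
  have hyC : Proj.mk y ∈ projImage C := (Proj.mk_eq_iff.2 ⟨_, hy⟩) ▸ hbC
  have hw : toTVec (raise z R ε ⊔ y) ∈ C := by
    refine hC ⟨mem_inter.2 fun H' hH' => H'.toTVec_sup_mem (mem_inter.1 hx H' hH')
      (mem_inter.1 (toTVec_mem_inter hΓ hyC) H' hH'), mem_inter.2 fun H' hH' => ?_⟩
    -- For `H'` with apex `z`: `y - z` attains its maximum `ε` in the sectors, and the supremum
    -- stays below `z + ε`.
    obtain ⟨i, hi, hmax⟩ := (H'.toTVec_mem_iff hH'.1.symm y).1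
      (HalfSpace.toTVec_mem_of_mem_projImage hH'.2 hyC)
    refine (H'.toTVec_mem_iff hH'.1.symm _).2 ⟨i, hi, fun k => ?_⟩
    have h1 := hmax t
    have h2 := le_sup_right (a := raise z R ε i) (b := y i)
    have h3 : raise z R ε k ⊔ y k ≤ z k + ε :=
      sup_le (raise_le hε.le k) (by linarith [hy k, htmax k])
    simp only [Pi.sup_apply]
    linarith [hy t]
  obtain ⟨i, hi, hmax⟩ := (H.toTVec_mem_iff hb _).1 (hH.1 hw)
  have h1 := hmax j
  have h2 := le_sup_left (a := raise z R ε j) (b := y j)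
  rw [raise_of_notMem hjR] at h2
  -- The supremum is strictly below `b + ε` on the sectors of `H`, yet at least `b j + ε` at `j`.
  have h3 : raise z R ε i ⊔ y i < b i + ε := by
    refine sup_lt_iff.2 ⟨?_, by linarith [hy i]⟩
    rcases (ht.1 i).lt_or_eq with hlt | heq
    · linarith [raise_le (z := z) (R := R) hε.le i]
    · rw [raise_of_mem (hM i hi heq)]; linarith
  simp only [Pi.sup_apply, raise_of_notMem hjR] at h1
  linarith

/-- If `C` is cut out by half-spaces whose apices differ from `a`, then the half-spaces with apex
`a` can be dropped from any representation of `C`. -/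
theorem inter_subset_of_inter_subset {C : Set (TVec n)} {Γ Λ : Set (HalfSpace n)}
    (hfin : Γ.Finite) (hΓ : Γ ⊆ sigma C) {a : Proj n} (ha : a ∈ projImage C)
    (hC : inter Γ ∩ inter (sigmaAt C a) ⊆ C) (hfin' : Λ.Finite) (hΛ : Λ ⊆ sigma C \ sigmaAt C a)
    (hC' : inter Λ ⊆ C) : inter Γ ⊆ C := by
  refine fun y hy => hC ⟨hy, mem_inter.2 fun H hH => ?_⟩
  revert y
  obtain ⟨rfl, hCH⟩ := hH
  refine (inter_subset_iff_reach hfin fun z hz => toTVec_mem_inter hΓ (hz ▸ ha)).2 ?_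
  obtain ⟨z, hz⟩ := Proj.exists_rep H.apex
  rw [← hz] at hC ha ⊢
  by_contra hcon
  -- The reachable set computed from `Γ` is also closed for `Λ`, so raising outside it stays in
  -- `inter Λ ⊆ C` while leaving `H`.
  have hR : ∀ H' ∈ Λ, ClosedUnder H' z {j | (tangentHypergraph Γ (Proj.mk z)).Reach H.sect j} :=
    fun H' hH' => closedUnder_of_closedUnder hfin hΓ ha hC
      (fun H'' hH'' => closedUnder_reach hH'' z _) (hΛ hH').1
      fun h => (hΛ hH').2 ⟨h.trans hz, (hΛ hH').1.1⟩
  obtain ⟨ε, hε, hmem⟩ := exists_raise_mem_inter hfin'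
    (toTVec_mem_inter (fun H' hH' => (hΛ hH').1) ha) hR
  exact raise_notMem hz (fun i hi => .base hi)
    (fun h' => hcon fun j => (Set.eq_univ_iff_forall.1 h') j) hε (hCH (hC' hmem))

/-! ### Boundary points and spanning sets -/

theorem HalfSpace.isClosed_setOf_toTVec_mem (H : HalfSpace n) :
    IsClosed {x : Fin n → ℝ | toTVec x ∈ H.toSet} := by
  obtain ⟨b, hb⟩ := Proj.exists_rep H.apex
  have : {x : Fin n → ℝ | toTVec x ∈ H.toSet} =
      ⋃ i ∈ H.sect, ⋂ k, {x | x k - b k ≤ x i - b i} := by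
    ext x
    simp [H.toTVec_mem_iff hb]
  rw [this]
  exact Set.Finite.isClosed_biUnion H.sect.finite_toSet fun i _ =>
    isClosed_iInter fun k => isClosed_le (by fun_prop) (by fun_prop)

/-- Needed so that boundary points of `C` belong to `C`. -/
theorem isClosed_projImage {C : Set (TVec n)} {Λ : Set (HalfSpace n)}
    (hΛ : ∀ H ∈ Λ, C ⊆ H.toSet) (hC : inter Λ ⊆ C) :
    IsClosed (projImage C) := by
  refine (isQuotientMap_quotient_mk' (s := projSetoid n)).isClosed_preimage.1 ?_
  have : (Quotient.mk (projSetoid n)) ⁻¹' projImage C =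
      ⋂ H ∈ Λ, {x : Fin n → ℝ | toTVec x ∈ H.toSet} := by
    ext x
    simp only [Set.mem_iInter, Set.mem_ofPred_eq]
    exact ⟨fun h H hH => HalfSpace.toTVec_mem_of_mem_projImage (hΛ H hH) h,
      fun h => ⟨x, rfl, hC (mem_inter.2 h)⟩⟩
  exact this ▸ isClosed_biInter fun H _ => H.isClosed_setOf_toTVec_mem

/-- Raising the coordinates outside the sectors, by however little, leaves `H` and hence `C`. -/
theorem apex_mem_bdry {C : Set (TVec n)} {H : HalfSpace n} (hH : H ∈ sigma C) :
    H.apex ∈ bdry C := by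
  refine ⟨subset_closure hH.2, fun hint => ?_⟩
  obtain ⟨b, hb⟩ := Proj.exists_rep H.apex
  have hcont : Continuous fun ε : ℝ => (Proj.mk (raise b (H.sect : Set (Fin n)) ε) : Proj n) := by
    refine Continuous.comp (continuous_quotient_mk' (s := projSetoid n)) (continuous_pi fun i => ?_)
    unfold raise
    split_ifs <;> fun_prop
  have h0 : Proj.mk (raise b (H.sect : Set (Fin n)) 0) ∈ interior (projImage C) := by
    have : raise b (H.sect : Set (Fin n)) 0 = b := by
      funext i; simp [raise]
    rwa [this, hb]
  have hev : ∀ᶠ ε : ℝ in 𝓝[>] 0,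
      Proj.mk (raise b (H.sect : Set (Fin n)) ε) ∈ interior (projImage C) :=
    (hcont.continuousAt.eventually_mem (isOpen_interior.mem_nhds h0)).filter_mono
      nhdsWithin_le_nhds
  obtain ⟨ε, hε, hpos⟩ := (hev.and self_mem_nhdsWithin).exists
  exact raise_notMem hb subset_rfl (by exact_mod_cast H.sect_ne_univ) hpos
    (HalfSpace.toTVec_mem_of_mem_projImage hH.1 (interior_subset hε))

theorem bdry_subset_projImage {C : Set (TVec n)} {Λ : Set (HalfSpace n)}
    (hΛ : ∀ H ∈ Λ, C ⊆ H.toSet) (hC : inter Λ ⊆ C) : bdry C ⊆ projImage C :=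
  (isClosed_projImage hΛ hC).frontier_subset

theorem sigmaAt_subset_sigma {C : Set (TVec n)} {a : Proj n} (ha : a ∈ projImage C) :
    sigmaAt C a ⊆ sigma C :=
  fun _ hH => ⟨hH.2, hH.1 ▸ ha⟩

theorem finite_sigmaAt (C : Set (TVec n)) (a : Proj n) : (sigmaAt C a).Finite := by
  refine Set.Finite.of_finite_image (f := HalfSpace.sect) (Set.toFinite _) ?_
  intro H hH H' hH' h
  exact HalfSpace.ext (hH.1.trans hH'.1.symm) h

theorem biUnion_sigmaAt_subset_sigma {C : Set (TVec n)} {X : Set (Proj n)}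
    (hX : X ⊆ projImage C) : ⋃ b ∈ X, sigmaAt C b ⊆ sigma C :=
  Set.iUnion₂_subset fun _ hb => sigmaAt_subset_sigma (hX hb)

/-- Apices of `Σ` are boundary points, so spanning the boundary amounts to implying all of `Σ`,
which cuts out `C`. -/
theorem tau'_eq_bdry_iff {C : Set (TVec n)} (hC : inter (sigma C) ⊆ C) (X : Set (Proj n)) :
    tau' C X = bdry C ↔ inter (⋃ b ∈ X, sigmaAt C b) ⊆ C := by
  constructor
  · refine fun h y hy => hC (mem_inter.2 fun H hH => ?_)
    have hmem : H.apex ∈ tau' C X := h ▸ apex_mem_bdry hH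
    exact (hmem.2 ⟨rfl, hH.1⟩).2 hy
  · refine fun h => subset_antisymm (fun _ hb => hb.1) fun b hb => ⟨hb, fun H hH => ?_⟩
    exact ⟨sigmaAt_subset_sigma (bdry_subset_projImage (fun _ h => h.1) hC hb) hH, h.trans hH.2⟩

/-- Anti-exchange is used both ways: if `Γ` cuts out `C`, then `a` can be removed from any spanning
set; if a spanning set avoids `a`, then `Γ` alone cuts out `C`. -/
theorem isNonredundantApex_iff {C : Set (TVec n)} (hC : inter (sigma C) ⊆ C) {a : Proj n}
    (ha : a ∈ bdry C) {Γ : Set (HalfSpace n)} (hfin : Γ.Finite) (hΓ : Γ ⊆ sigma C \ sigmaAt C a)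
    (hrep : inter Γ ∩ inter (sigmaAt C a) ⊆ C) :
    IsNonredundantApex C a ↔ ¬ inter Γ ⊆ C := by
  have ha' := bdry_subset_projImage (fun _ h => h.1) hC ha
  constructor
  · rintro ⟨X, hX, haX⟩ hΓC
    obtain ⟨⟨hXb, hXfin, hXspan⟩, hmin⟩ := hX
    rw [tau'_eq_bdry_iff hC] at hXspan
    have hXa : X \ {a} ⊆ projImage C :=
      Set.sdiff_subset.trans (hXb.trans (bdry_subset_projImage (fun _ h => h.1) hC))
    have hspan : inter (⋃ b ∈ X \ {a}, sigmaAt C b) ⊆ C := by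
      refine inter_subset_of_inter_subset (hXfin.sdiff.biUnion fun b _ => finite_sigmaAt C b)
        (biUnion_sigmaAt_subset_sigma hXa) ha' ?_ hfin hΓ hΓC
      rintro y ⟨hy, hya⟩
      refine hXspan (mem_inter.2 fun H hH => ?_)
      obtain ⟨b, hb, hHb⟩ := Set.mem_iUnion₂.1 hH
      by_cases hba : b = a
      · exact mem_inter.1 hya H (hba ▸ hHb)
      · exact mem_inter.1 hy H (Set.mem_iUnion₂.2 ⟨b, ⟨hb, hba⟩, hHb⟩)
    exact (hmin ⟨Set.sdiff_subset.trans hXb, hXfin.sdiff, (tau'_eq_bdry_iff hC _).2 hspan⟩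
      Set.sdiff_subset haX).2 rfl
  · intro hΓC
    have hX₀fin : (insert a (HalfSpace.apex '' Γ)).Finite := (hfin.image _).insert a
    have hX₀ : insert a (HalfSpace.apex '' Γ) ⊆ bdry C := by
      rintro b (rfl | ⟨H, hH, rfl⟩)
      · exact ha
      · exact apex_mem_bdry (hΓ hH).1
    have hspan : tau' C (insert a (HalfSpace.apex '' Γ)) = bdry C := by
      refine (tau'_eq_bdry_iff hC _).2 fun y hy => hrep ⟨mem_inter.2 fun H hH => ?_,
        mem_inter.2 fun H hH => ?_⟩
      · exact mem_inter.1 hy H (Set.mem_iUnion₂.2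
          ⟨H.apex, Or.inr ⟨H, hH, rfl⟩, rfl, (hΓ hH).1.1⟩)
      · exact mem_inter.1 hy H (Set.mem_iUnion₂.2 ⟨a, Or.inl rfl, hH⟩)
    -- A spanning set minimal among the subsets of this finite one is minimal among all.
    obtain ⟨X, hX⟩ := Set.Finite.exists_minimal
      (s := {Y | Y ⊆ insert a (HalfSpace.apex '' Γ) ∧ tau' C Y = bdry C})
      (hX₀fin.finite_subsets.subset fun Y hY => hY.1) ⟨_, subset_rfl, hspan⟩
    have hXfin := hX₀fin.subset hX.prop.1
    have hXb := hX.prop.1.trans hX₀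
    refine ⟨X, ⟨⟨hXb, hXfin, hX.prop.2⟩, fun Y hY hYX =>
      hX.2 ⟨hYX.trans hX.prop.1, hY.2.2⟩ hYX⟩, ?_⟩
    by_contra haX
    refine hΓC (inter_subset_of_inter_subset hfin (fun H hH => (hΓ hH).1) ha' hrep
      (hXfin.biUnion fun b _ => finite_sigmaAt C b) (fun H hH => ⟨?_, fun hHa => ?_⟩)
      ((tau'_eq_bdry_iff hC X).1 hX.prop.2))
    · exact biUnion_sigmaAt_subset_sigma (hXb.trans (bdry_subset_projImage (fun _ h => h.1) hC)) hH
    · obtain ⟨b, hb, hHb⟩ := Set.mem_iUnion₂.1 hH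
      exact haX (hHa.1.symm.trans hHb.1 ▸ hb)

/-! ### Maximal strongly connected components of a transitive digraph -/

theorem diPath_iff_adj {V : Type*} {G : Digraph V} (hrefl : ∀ v, G.Adj v v)
    (htrans : ∀ u v w, G.Adj u v → G.Adj v w → G.Adj u w) {u v : V} :
    DiPath G u v ↔ G.Adj u v := by
  refine ⟨fun h => ?_, Relation.ReflTransGen.single⟩
  induction h with
  | refl => exact hrefl u
  | tail _ h ih => exact htrans _ _ _ ih h

theorem IsSCC.diPath {V : Type*} {G : Digraph V} {K : Set V} (hK : IsSCC G K) {u v : V}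
    (hu : u ∈ K) (hv : v ∈ K) : DiPath G u v := by
  obtain ⟨w, rfl⟩ := hK
  exact hu.2.trans hv.1

theorem IsSCC.mem {V : Type*} {G : Digraph V} {K : Set V} (hK : IsSCC G K) {u v : V}
    (hu : u ∈ K) (h : DiPath G u v) (h' : DiPath G v u) : v ∈ K := by
  obtain ⟨w, rfl⟩ := hK
  exact ⟨hu.1.trans h, h'.trans hu.2⟩

theorem IsSCC.eq_of_mem {V : Type*} {G : Digraph V} {K K' : Set V} (hK : IsSCC G K)
    (hK' : IsSCC G K') {u : V} (hu : u ∈ K) (hu' : u ∈ K') : K = K' :=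
  Set.ext fun _ => ⟨fun hv => hK'.mem hu' (hK.diPath hu hv) (hK.diPath hv hu),
    fun hv => hK.mem hu (hK'.diPath hu' hv) (hK'.diPath hv hu')⟩

theorem IsSCC.nonempty {V : Type*} {G : Digraph V} {K : Set V} (hK : IsSCC G K) :
    K.Nonempty := by
  obtain ⟨w, rfl⟩ := hK
  exact ⟨w, .refl, .refl⟩

theorem IsMaximalSCC.mem_of_diPath {V : Type*} {G : Digraph V} {K : Set V}
    (hK : IsMaximalSCC G K) {u v : V} (hu : u ∈ K) (h : DiPath G u v) : v ∈ K := by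
  have := hK.2 {w | DiPath G v w ∧ DiPath G w v} ⟨v, rfl⟩ fun x hx y hy =>
    (hK.1.diPath hx hu).trans (h.trans hy.1)
  exact this ▸ ⟨.refl, .refl⟩

theorem exists_isMaximalSCC_diPath {V : Type*} [Finite V] (G : Digraph V) (v : V) :
    ∃ K, IsMaximalSCC G K ∧ ∃ u ∈ K, DiPath G v u := by
  -- The class of a maximal element above `v` in the reachability preorder is the required
  -- component.
  let _ : Preorder V :=
    { le := DiPath G
      le_refl := fun _ => .refl
      le_trans := fun _ _ _ h h' => Relation.ReflTransGen.trans h h' }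
  obtain ⟨w, hvw, hw⟩ := Finite.exists_le_maximal (p := fun _ : V => True) (a := v) trivial
  refine ⟨{u | DiPath G w u ∧ DiPath G u w}, ⟨⟨w, rfl⟩, fun K' hK' h => ?_⟩, w,
    ⟨.refl, .refl⟩, hvw⟩
  obtain ⟨x, hx⟩ := hK'.nonempty
  have hwx : DiPath G w x := h w ⟨.refl, .refl⟩ x hx
  exact hK'.eq_of_mem ⟨w, rfl⟩ hx ⟨hwx, hw.2 trivial hwx⟩

/-- The minimal sets meeting each maximal strongly connected component are the transversals. -/
theorem minimal_iff_isTransversalOfMaximalSCCs {V ι : Type*} {G : Digraph V} {N : ι → V}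
    {P : Set ι → Prop} (hP : ∀ L, P L ↔ ∀ K, IsMaximalSCC G K → ∃ l ∈ L, N l ∈ K) (L : Set ι) :
    Minimal P L ↔ IsTransversalOfMaximalSCCs G N L := by
  constructor
  · intro hL
    have hit := (hP L).1 hL.prop
    have hdrop : ∀ l ∈ L, ¬ P (L \ {l}) := fun l hl h => (hL.2 h Set.sdiff_subset hl).2 rfl
    refine ⟨fun l hl => ?_, fun K hK => ?_⟩
    · by_contra hcon
      refine hdrop l hl ((hP _).2 fun K hK => ?_)
      obtain ⟨l', hl', hmem⟩ := hit K hK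
      exact ⟨l', ⟨hl', fun h => hcon ⟨K, hK, (show l' = l from h) ▸ hmem⟩⟩, hmem⟩
    · obtain ⟨l, hl, hlK⟩ := hit K hK
      refine ⟨l, ⟨hl, hlK⟩, fun l' ⟨hl', hlK'⟩ => ?_⟩
      by_contra hne
      refine hdrop l' hl' ((hP _).2 fun K' hK' => ?_)
      obtain ⟨m, hm, hmK⟩ := hit K' hK'
      by_cases hml : m = l'
      · have : K = K' := hK.1.eq_of_mem hK'.1 hlK' (hml ▸ hmK)
        exact ⟨l, ⟨hl, fun h => hne h.symm⟩, this ▸ hlK⟩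
      · exact ⟨m, ⟨hm, hml⟩, hmK⟩
  · rintro ⟨h1, h2⟩
    refine ⟨(hP L).2 fun K hK => ?_, fun L' hL' hsub l hl => ?_⟩
    · obtain ⟨l, h, -⟩ := h2 K hK
      exact ⟨l, h⟩
    · obtain ⟨K, hK, hlK⟩ := h1 l hl
      obtain ⟨l', hl', hlK'⟩ := (hP L').1 hL' K hK
      exact (h2 K hK).unique ⟨hl, hlK⟩ ⟨hsub hl', hlK'⟩ ▸ hl'

/-- If all nodes can be reached from `u` but not conversely, then a set of nodes such that each
node leads to `u` or to the set is one which meets each maximal strongly connected component. -/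
theorem forall_diPath_iff_forall_isMaximalSCC {V ι : Type*} [Finite V] {G : Digraph V} {u : V}
    (hu : ∀ v, DiPath G u v) (hG : ¬ StronglyConnected G) (N : ι → V) (L : Set ι) :
    (∀ v, DiPath G v u ∨ ∃ l ∈ L, DiPath G v (N l)) ↔
      ∀ K, IsMaximalSCC G K → ∃ l ∈ L, N l ∈ K := by
  constructor
  · intro h K hK
    obtain ⟨v, hv⟩ := hK.1.nonempty
    rcases h v with hvu | ⟨l, hl, hvl⟩
    -- A maximal component with a node leading to `u` would contain every node.
    · refine absurd (fun x y => ?_) hG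
      have hall : ∀ w, w ∈ K := fun w => hK.mem_of_diPath hv (hvu.trans (hu w))
      exact hK.1.diPath (hall x) (hall y)
    · exact ⟨l, hl, hK.mem_of_diPath hv hvl⟩
  · intro h v
    obtain ⟨K, hK, w, hw, hvw⟩ := exists_isMaximalSCC_diPath G v
    obtain ⟨l, hl, hlK⟩ := h K hK
    exact Or.inr ⟨l, hl, hvw.trans (hK.1.diPath hw hlK)⟩

/-! ### The reachability digraph -/

theorem reachDigraph_diPath_iff {C : Set (TVec n)} {Γ : Set (HalfSpace n)} {a : Proj n}
    {I J : sectorSets C a} : DiPath (reachDigraph C Γ a) I J ↔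
      ∀ j ∈ J.1, (tangentHypergraph Γ a).Reach I.1 j :=
  diPath_iff_adj (fun _ _ hj => .base hj) fun _ _ _ h h' j hj => (h' j hj).trans h

/-- The node `[n]` of the reachability digraph. -/
def univNode (C : Set (TVec n)) (a : Proj n) : sectorSets C a := ⟨Finset.univ, Or.inl rfl⟩

theorem univNode_diPath {C : Set (TVec n)} {Γ : Set (HalfSpace n)} {a : Proj n}
    (J : sectorSets C a) : DiPath (reachDigraph C Γ a) (univNode C a) J :=
  reachDigraph_diPath_iff.2 fun j _ => .base (Finset.mem_univ j)

theorem inter_union_image_subset_iff {C : Set (TVec n)} {Γ : Set (HalfSpace n)}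
    (hfin : Γ.Finite) (hΓ : Γ ⊆ sigma C) {a : Proj n} (ha : a ∈ projImage C) {q : ℕ}
    {H : Fin q → HalfSpace n} (hH : ∀ l, H l ∈ sigmaAt C a) (L : Set (Fin q)) {H₀ : HalfSpace n}
    (hH₀ : H₀ ∈ sigmaAt C a) :
    inter (Γ ∪ H '' L) ⊆ H₀.toSet ↔
      DiPath (reachDigraph C Γ a) (sectorNode H₀ hH₀) (univNode C a) ∨
        ∃ l ∈ L, DiPath (reachDigraph C Γ a) (sectorNode H₀ hH₀) (sectorNode (H l) (hH l)) := by
  have hmono : inter (Γ ∪ H '' L) ⊆ inter Γ := fun y hy =>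
    mem_inter.2 fun H' hH' => mem_inter.1 hy H' (Or.inl hH')
  simp only [reachDigraph_diPath_iff]
  constructor
  · intro h
    by_contra hcon
    push Not at hcon
    obtain ⟨hu, hl⟩ := hcon
    obtain ⟨z, rfl⟩ := Proj.exists_rep a
    obtain ⟨ε, hε, hmem⟩ := exists_raise_mem_inter (Γ := Γ ∪ H '' L) (z := z)
      (R := {j | (tangentHypergraph Γ (Proj.mk z)).Reach H₀.sect j})
      (hfin.union (Set.toFinite _)) (toTVec_mem_inter (Set.union_subset hΓ (by
        rintro _ ⟨l, -, rfl⟩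
        exact sigmaAt_subset_sigma ha (hH l))) ha) (by
        rintro H' (hH' | ⟨l, hl', rfl⟩)
        · exact closedUnder_reach hH' z _
        -- The sectors of `H l` are not all reachable from `H₀.sect`, so `H l` imposes no closure
        -- condition.
        · refine closedUnder_of_apex_eq (hH l).1 fun hsub => ?_
          obtain ⟨j, hj, hj'⟩ := hl l hl'
          exact hj' (hsub hj))
    refine raise_notMem hH₀.1.symm (fun i hi => .base hi) (fun h' => ?_) hε (h hmem)
    obtain ⟨j, -, hj⟩ := hu
    exact hj ((Set.eq_univ_iff_forall.1 h') j)
  · obtain ⟨rfl, -⟩ := hH₀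
    rintro (h | ⟨l, hl, h⟩) y hy
    · exact inter_subset_of_reach h (hmono hy) (Or.inl rfl)
    · exact inter_subset_of_reach h (hmono hy)
        (Or.inr ⟨H l, (hH l).1, rfl, mem_inter.1 hy _ (Or.inr ⟨l, hl, rfl⟩)⟩)

theorem stronglyConnected_reachDigraph_iff {C : Set (TVec n)} {Γ : Set (HalfSpace n)}
    (hfin : Γ.Finite) (hΓ : Γ ⊆ sigma C) {a : Proj n} (ha : a ∈ projImage C)
    (hrep : inter Γ ∩ inter (sigmaAt C a) ⊆ C) :
    StronglyConnected (reachDigraph C Γ a) ↔ inter Γ ⊆ C := by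
  have key : ∀ (H : HalfSpace n) (hH : H ∈ sigmaAt C a), inter Γ ⊆ H.toSet ↔
      DiPath (reachDigraph C Γ a) (sectorNode H hH) (univNode C a) := by
    intro H hH
    -- The empty family leaves only the alternative of reaching `[n]`.
    simpa using inter_union_image_subset_iff hfin hΓ ha (q := 0) (H := Fin.elim0)
      (fun l => l.elim0) ∅ hH
  constructor
  · exact fun h y hy => hrep ⟨hy, mem_inter.2 fun H hH => (key H hH).2 (h _ _) hy⟩
  · intro h I J
    refine Relation.ReflTransGen.trans ?_ (univNode_diPath J)
    obtain ⟨I, rfl | ⟨H, hH, rfl⟩⟩ := I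
    · exact .refl
    · exact (key H hH).1 (h.trans hH.2)

/-- By `hrep` the full family implies all of `Σ`, so only the half-spaces with apex `a` need testing
against `Γ` and the `H l`, `l ∈ L`. -/
theorem isCompletion_iff {C : Set (TVec n)} {Γ : Set (HalfSpace n)}
    (hfin : Γ.Finite) (hΓ : Γ ⊆ sigma C) {a : Proj n} (ha : a ∈ projImage C) {q : ℕ}
    {H : Fin q → HalfSpace n} (hH : ∀ l, H l ∈ sigmaAt C a)
    (hrep : inter (Γ ∪ Set.range H) ⊆ C) (L : Set (Fin q)) :
    IsCompletion C Γ H L ↔ ∀ I, DiPath (reachDigraph C Γ a) I (univNode C a) ∨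
      ∃ l ∈ L, DiPath (reachDigraph C Γ a) I (sectorNode (H l) (hH l)) := by
  have htau : ∀ {Λ : Set (HalfSpace n)}, inter Λ ⊆ C → tau C Λ = sigma C := fun h =>
    subset_antisymm (fun _ hx => hx.1) fun H' hH' => ⟨hH', h.trans hH'.1⟩
  constructor
  · rintro ⟨h1, h2⟩ ⟨I, rfl | ⟨H₀, hH₀, rfl⟩⟩
    · exact Or.inl .refl
    · have hmem : H₀ ∈ tau C (Γ ∪ H '' L) :=
        (h1.trans h2).symm ▸ sigmaAt_subset_sigma ha hH₀
      exact (inter_union_image_subset_iff hfin hΓ ha hH L hH₀).1 hmem.2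
  · intro h
    have hsub : inter (Γ ∪ H '' L) ⊆ C := by
      refine fun y hy => hrep (mem_inter.2 ?_)
      rintro _ (hH' | ⟨l, rfl⟩)
      · exact mem_inter.1 hy _ (Or.inl hH')
      · exact (inter_union_image_subset_iff hfin hΓ ha hH L (hH l)).2 (h _) hy
    exact ⟨(htau hsub).trans (htau hrep).symm, htau hrep⟩

end TropicalCone

theorem mainTheorem4 {n q : ℕ} (C : Set (TropicalCone.TVec n))
    (hC : TropicalCone.IsRealPolyhedralCone C)
    (a : TropicalCone.Proj n) (ha : a ∈ TropicalCone.bdry C)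
    (H : Fin q → TropicalCone.HalfSpace n) (hH : ∀ l, H l ∈ TropicalCone.sigmaAt C a)
    (Γ : Set (TropicalCone.HalfSpace n)) (hΓfin : Γ.Finite)
    (hΓ : Γ ⊆ TropicalCone.sigma C \ TropicalCone.sigmaAt C a)
    (hrep : C = TropicalCone.inter Γ ∩ ⋂ l, (H l).toSet) :
    (TropicalCone.IsNonredundantApex C a ↔
      ¬ TropicalCone.StronglyConnected (TropicalCone.reachDigraph C Γ a)) ∧
    (TropicalCone.IsNonredundantApex C a → ∀ L : Set (Fin q),
      (Minimal (TropicalCone.IsCompletion C Γ H) L ↔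
        TropicalCone.IsTransversalOfMaximalSCCs (TropicalCone.reachDigraph C Γ a)
          (fun l => TropicalCone.sectorNode (H l) (hH l)) L)) := by
  have hΓ' : Γ ⊆ TropicalCone.sigma C := fun _ h => (hΓ h).1
  have hsub : TropicalCone.inter (Γ ∪ Set.range H) ⊆ C := fun y hy => hrep.symm ▸
    ⟨TropicalCone.mem_inter.2 fun H' h => TropicalCone.mem_inter.1 hy H' (Or.inl h),
      Set.mem_iInter.2 fun l => TropicalCone.mem_inter.1 hy _ (Or.inr ⟨l, rfl⟩)⟩
  have hrepAt : TropicalCone.inter Γ ∩ TropicalCone.inter (TropicalCone.sigmaAt C a) ⊆ C := by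
    rintro y ⟨hy, hya⟩
    exact hrep.symm ▸ ⟨hy, Set.mem_iInter.2 fun l => TropicalCone.mem_inter.1 hya _ (hH l)⟩
  have ha' : a ∈ TropicalCone.projImage C := TropicalCone.bdry_subset_projImage
    (by rintro H' (h | ⟨l, rfl⟩); exacts [(hΓ' h).1, (hH l).2]) hsub ha
  have hsigma : TropicalCone.inter (TropicalCone.sigma C) ⊆ C := fun y hy =>
    hrepAt ⟨TropicalCone.mem_inter.2 fun H' h => TropicalCone.mem_inter.1 hy H' (hΓ' h),
      TropicalCone.mem_inter.2 fun H' h =>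
        TropicalCone.mem_inter.1 hy H' (TropicalCone.sigmaAt_subset_sigma ha' h)⟩
  have hiff := (TropicalCone.isNonredundantApex_iff hsigma ha hΓfin hΓ hrepAt).trans
    (not_congr (TropicalCone.stronglyConnected_reachDigraph_iff hΓfin hΓ' ha' hrepAt).symm)
  refine ⟨hiff, fun hna L => TropicalCone.minimal_iff_isTransversalOfMaximalSCCs (fun L' => ?_) L⟩
  exact (TropicalCone.isCompletion_iff hΓfin hΓ' ha' hH hsub L').trans
    (TropicalCone.forall_diPath_iff_forall_isMaximalSCC TropicalCone.univNode_diPath (hiff.1 hna)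
      _ L')
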